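/- Let $[n]=\{1,\dots,n\}$. Families $\mathcal A_1,\mathcal A_2,\mathcal A_3\subseteq 2^{[n]}$ are called \emph{sunflower-free} if there are no sets $A_1\in\mathcal A_1$, $A_2\in\mathcal A_2$, $A_3\in\mathcal A_3$ and $C\subseteq[n]$ such that $A_i\cap A_j=C$ for all $i\neq j$ and $A_i\setminus C\neq\emptyset$ for $i=1,2,3$. Let $P(n,3)$ be the maximum of $|\mathcal A_1||\mathcal A_2||\mathcal A_3|$ over all sunflower-free triples $(\mathcal A_1,\mathcal A_2,\mathcal A_3)$ of families of subsets of $[n]$. Then, as $n\to\infty$, $$\left(\frac18+o(1)\right)2^{3n}\le P(n,3)\le\left(0.13075+o(1)\right)2^{3n}.$$ -/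

import Mathlib

/-- The families `𝒜 i ⊆ 2^[n]`, `i < k`, contain a multicolor sunflower with `k` petals: there are
sets `A i ∈ 𝒜 i` and a core `C` such that `A i ∩ A j = C` for all `i ≠ j`, and every petal
`A i \ C` is nonempty. The ground set `[n]` is modelled by `Fin n`. -/
def HasMulticolorSunflower {n k : ℕ} (𝒜 : Fin k → Finset (Finset (Fin n))) : Prop :=
  ∃ (A : Fin k → Finset (Fin n)) (C : Finset (Fin n)),
    (∀ i, A i ∈ 𝒜 i) ∧ (∀ i j, i ≠ j → A i ∩ A j = C) ∧ ∀ i, (A i \ C).Nonempty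

/-- The families `𝒜 i`, `i < k`, are sunflower-free. -/
def MulticolorSunflowerFree {n k : ℕ} (𝒜 : Fin k → Finset (Finset (Fin n))) : Prop :=
  ¬ HasMulticolorSunflower 𝒜

open Classical in
/-- The collection of all `k`-tuples of families of subsets of `[n]` that are sunflower-free. -/
noncomputable def sunflowerFreeTuples (n k : ℕ) : Finset (Fin k → Finset (Finset (Fin n))) :=
  Finset.univ.filter fun 𝒜 => MulticolorSunflowerFree 𝒜

/-- `P(n, k)`: the maximum of `∏ i, |𝒜 i|` over all sunflower-free `k`-tuples of families of
subsets of `[n]`. -/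
noncomputable def maxSunflowerFreeProd (n k : ℕ) : ℕ :=
  (sunflowerFreeTuples n k).sup fun 𝒜 => ∏ i, (𝒜 i).card

/-! For sets `X`, `Y` put `Z = (symmDiff X Y)ᶜ`. All pairwise intersections of `X`, `Y`, `Z` equal
`X ∩ Y`, and the petals are `X \ Y`, `Y \ X` and `(X ∪ Y)ᶜ`, so they form a sunflower unless `X`,
`Y` are comparable or cover the ground set; at most `3 * 3 ^ n` pairs do. For fixed `X ∈ 𝒜 i`, the
family `𝒜 j` and the image of `𝒜 k` under `Z ↦ (symmDiff X Z)ᶜ` are thus nearly disjoint. On average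
over `X`, any two densities sum to at most `1 + o(1)` unless the third is negligible, so the product
is at most `1 / 8 + o(1)`. This is sharper than the constant `0.13075` and matches the lower bound,
given by the sets containing a point (twice) and those avoiding it. -/

open Finset in
/-- In a sunflower-free triple, a set from one family, a set from another and the complement of
their symmetric difference in the third form three sets one of whose petals is empty. -/
lemma MulticolorSunflowerFree.petal_empty {n : ℕ} {𝒜 : Fin 3 → Finset (Finset (Fin n))}
    (h : MulticolorSunflowerFree 𝒜) {i j k : Fin 3} (hij : i ≠ j) (hik : i ≠ k) (hjk : j ≠ k)
    {X Y : Finset (Fin n)} (hX : X ∈ 𝒜 i) (hY : Y ∈ 𝒜 j) (hZ : (symmDiff X Y)ᶜ ∈ 𝒜 k) :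
    X ⊆ Y ∨ Y ⊆ X ∨ Xᶜ ⊆ Y := by
  by_contra! hne
  obtain ⟨h₁, h₂, h₃⟩ := hne
  obtain ⟨x, hxX, hxY⟩ := not_subset.1 h₁
  obtain ⟨y, hyY, hyX⟩ := not_subset.1 h₂
  obtain ⟨z, hzX, hzY⟩ := not_subset.1 h₃
  rw [mem_compl] at hzX
  have cover : ∀ l : Fin 3, l = i ∨ l = j ∨ l = k := by omega
  refine h ⟨fun l => if l = i then X else if l = j then Y else (symmDiff X Y)ᶜ, X ∩ Y, ?_, ?_, ?_⟩
  · intro l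
    rcases cover l with rfl | rfl | rfl
    · simpa using hX
    · simpa [hij.symm] using hY
    · simpa [hik.symm, hjk.symm] using hZ
  · have e₁ : X ∩ (symmDiff X Y)ᶜ = X ∩ Y := by
      ext w; simp only [mem_inter, mem_compl, mem_symmDiff]; tauto
    have e₂ : Y ∩ (symmDiff X Y)ᶜ = X ∩ Y := by
      ext w; simp only [mem_inter, mem_compl, mem_symmDiff]; tauto
    intro l m hlm
    rcases cover l with rfl | rfl | rfl <;> rcases cover m with rfl | rfl | rfl <;>
      simp_all [inter_comm, eq_comm]
  · intro l
    rcases cover l with rfl | rfl | rfl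
    · exact ⟨x, by simp [hxX, hxY]⟩
    · exact ⟨y, by simp [hij.symm, hyX, hyY]⟩
    · exact ⟨z, by simp [hik.symm, hjk.symm, hzX, hzY]⟩

open Finset in
/-- There are few pairs of sets that are comparable or cover the ground set. -/
lemma sum_card_filter_comparable_or_cover_le (n : ℕ) :
    ∑ X : Finset (Fin n), #{Y : Finset (Fin n) | X ⊆ Y ∨ Y ⊆ X ∨ Xᶜ ⊆ Y} ≤ 3 * 3 ^ n := by
  have up : ∀ X : Finset (Fin n), #{Y : Finset (Fin n) | X ⊆ Y} = 2 ^ (n - #X) := fun X => by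
    have e : ({Y : Finset (Fin n) | X ⊆ Y} : Finset _) = Icc X univ := by ext Y; simp
    rw [e, card_Icc_finset (subset_univ X), card_univ, Fintype.card_fin]
  have down : ∀ X : Finset (Fin n), #{Y : Finset (Fin n) | Y ⊆ X} = 2 ^ #X := fun X => by
    rw [← card_powerset]; congr 1; ext Y; simp
  have cover : ∀ X : Finset (Fin n), #{Y : Finset (Fin n) | Xᶜ ⊆ Y} = 2 ^ #X := fun X => by
    rw [up, card_compl, Fintype.card_fin, Nat.sub_sub_self (by simpa using card_le_univ X)]
  -- Binomial theorem for `(1 + 2) ^ n`.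
  have sum_up : ∑ X : Finset (Fin n), 2 ^ (n - #X) = 3 ^ n := by
    simpa using Fin.sum_pow_mul_eq_add_pow (n := n) (1 : ℕ) 2
  have sum_down : ∑ X : Finset (Fin n), 2 ^ #X = 3 ^ n := by
    simpa using Fin.sum_pow_mul_eq_add_pow (n := n) (2 : ℕ) 1
  calc _ ≤ ∑ X : Finset (Fin n), (2 ^ (n - #X) + (2 ^ #X + 2 ^ #X)) := by
        refine sum_le_sum fun X _ => ?_
        rw [filter_or, filter_or]
        refine (card_union_le _ _).trans (add_le_add (up X).le ?_)
        exact (card_union_le _ _).trans (add_le_add (down X).le (cover X).le)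
    _ = 3 * 3 ^ n := by
        rw [sum_add_distrib, sum_add_distrib, sum_up, sum_down]; ring

open Finset in
lemma MulticolorSunflowerFree.card_mul_add_le {n : ℕ} {𝒜 : Fin 3 → Finset (Finset (Fin n))}
    (h : MulticolorSunflowerFree 𝒜) {i j k : Fin 3} (hij : i ≠ j) (hik : i ≠ k) (hjk : j ≠ k) :
    #(𝒜 i) * (#(𝒜 j) + #(𝒜 k)) ≤ #(𝒜 i) * 2 ^ n + 3 * 3 ^ n := by
  have key : ∀ X ∈ 𝒜 i, #(𝒜 j) + #(𝒜 k) ≤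
      2 ^ n + #{Y : Finset (Fin n) | X ⊆ Y ∨ Y ⊆ X ∨ Xᶜ ⊆ Y} := by
    intro X hX
    have inj : Function.Injective fun Z : Finset (Fin n) => (symmDiff X Z)ᶜ :=
      compl_injective.comp (symmDiff_right_injective X)
    rw [← card_image_of_injective (𝒜 k) inj, ← card_union_add_card_inter]
    refine add_le_add ((card_le_univ _).trans (by simp)) (card_le_card fun Y hY => ?_)
    obtain ⟨hYj, hYk⟩ := mem_inter.1 hY
    obtain ⟨Z, hZ, rfl⟩ := mem_image.1 hYk
    -- The map is an involution, so the third set built from `X` and `Y` is `Z ∈ 𝒜 k`.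
    have e : (symmDiff X (symmDiff X Z)ᶜ)ᶜ = Z := by
      ext w; simp only [mem_compl, mem_symmDiff]; tauto
    simpa using h.petal_empty hij hik hjk hX hYj (by rwa [e])
  calc #(𝒜 i) * (#(𝒜 j) + #(𝒜 k)) = ∑ X ∈ 𝒜 i, (#(𝒜 j) + #(𝒜 k)) := by simp
    _ ≤ ∑ X ∈ 𝒜 i, (2 ^ n + #{Y : Finset (Fin n) | X ⊆ Y ∨ Y ⊆ X ∨ Xᶜ ⊆ Y}) := sum_le_sum key
    _ = #(𝒜 i) * 2 ^ n + ∑ X ∈ 𝒜 i, #{Y : Finset (Fin n) | X ⊆ Y ∨ Y ⊆ X ∨ Xᶜ ⊆ Y} := by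
        rw [sum_add_distrib]; simp
    _ ≤ _ := by
        gcongr
        exact (sum_le_sum_of_subset (subset_univ _)).trans
          (sum_card_filter_comparable_or_cover_le n)

/-- Three densities, each two of which have sum at most `1` up to an error, have product at most
`1 / 8` up to an error. -/
lemma mul_mul_le_of_mul_add_le {p q r δ : ℝ} (hδ : 0 ≤ δ) (hp : 0 ≤ p) (hq : 0 ≤ q) (hr : 0 ≤ r)
    (hp1 : p ≤ 1) (hq1 : q ≤ 1) (hr1 : r ≤ 1) (h₁ : p * (q + r) ≤ p + δ)
    (h₂ : q * (p + r) ≤ q + δ) (h₃ : r * (p + q) ≤ r + δ) : p * q * r ≤ 1 / 8 + √δ := by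
  set η := √δ with hη
  have η0 : 0 ≤ η := Real.sqrt_nonneg δ
  have hδη : δ = η * η := (Real.mul_self_sqrt hδ).symm
  have hpq : p * q ≤ 1 := mul_le_one₀ hp1 hq hq1
  rcases le_total 1 η with h1 | h1
  · linarith [mul_le_one₀ hpq hr hr1]
  -- A density at most `η` already makes the product at most `η`.
  rcases le_or_gt p η with hpη | hpη
  · nlinarith [mul_le_of_le_one_right (mul_nonneg hp hq) hr1, mul_le_of_le_one_right hp hq1]
  rcases le_or_gt q η with hqη | hqη
  · nlinarith [mul_le_of_le_one_right (mul_nonneg hp hq) hr1, mul_le_of_le_one_left hq hp1]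
  rcases le_or_gt r η with hrη | hrη
  · nlinarith [mul_le_of_le_one_left hr hpq]
  have pair : ∀ {x y z : ℝ}, η < x → 0 ≤ y → 0 ≤ z → x * (y + z) ≤ x + δ →
      y * z ≤ ((1 + η) / 2) ^ 2 := by
    intro x y z hx hy hz h
    -- Since `x > η` and `δ = η * η`, dividing by `x` leaves an error of at most `η`.
    have : y + z ≤ 1 + η := by
      have hx0 : 0 < x := η0.trans_lt hx
      refine le_of_mul_le_mul_left (h.trans ?_) hx0
      nlinarith
    nlinarith [sq_nonneg (y - z)]
  have a₁ := pair hpη hq hr h₁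
  have a₂ := pair hqη hp hr h₂
  have a₃ := pair hrη hp hq h₃
  have sq : (p * q * r) ^ 2 ≤ (((1 + η) / 2) ^ 3) ^ 2 := by
    calc (p * q * r) ^ 2 = (q * r) * (p * r) * (p * q) := by ring
      _ ≤ ((1 + η) / 2) ^ 2 * ((1 + η) / 2) ^ 2 * ((1 + η) / 2) ^ 2 := by gcongr
      _ = _ := by ring
  have := le_of_sq_le_sq sq (by positivity)
  -- `(1 + η) ^ 3 ≤ 1 + 7 * η` for `0 ≤ η ≤ 1`.
  nlinarith [mul_nonneg η0 (sub_nonneg.2 h1), mul_nonneg (mul_nonneg η0 η0) (sub_nonneg.2 h1)]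

lemma MulticolorSunflowerFree.prod_card_le {n : ℕ} {𝒜 : Fin 3 → Finset (Finset (Fin n))}
    (h : MulticolorSunflowerFree 𝒜) :
    ((∏ i, (𝒜 i).card : ℕ) : ℝ) ≤ (1 / 8 + √(3 * (3 / 4) ^ n)) * 2 ^ (3 * n) := by
  have hN : (0 : ℝ) < 2 ^ n := by positivity
  have le1 : ∀ i, ((𝒜 i).card : ℝ) / 2 ^ n ≤ 1 := fun i => by
    rw [div_le_one hN]
    exact_mod_cast (Finset.card_le_univ (𝒜 i)).trans (by simp)
  have key : ∀ i j k : Fin 3, i ≠ j → i ≠ k → j ≠ k →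
      ((𝒜 i).card : ℝ) / 2 ^ n * (((𝒜 j).card : ℝ) / 2 ^ n + ((𝒜 k).card : ℝ) / 2 ^ n) ≤
        ((𝒜 i).card : ℝ) / 2 ^ n + 3 * (3 / 4) ^ n := by
    intro i j k hij hik hjk
    have c : ((𝒜 i).card : ℝ) * ((𝒜 j).card + (𝒜 k).card) ≤ (𝒜 i).card * 2 ^ n + 3 * 3 ^ n := by
      exact_mod_cast h.card_mul_add_le hij hik hjk
    have h4 : (4 : ℝ) ^ n = 2 ^ n * 2 ^ n := by rw [← mul_pow]; norm_num
    rw [div_pow, h4, ← add_div, div_mul_div_comm]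
    calc _ ≤ _ := div_le_div_of_nonneg_right c (by positivity)
      _ = _ := by field_simp
  have := mul_mul_le_of_mul_add_le (δ := 3 * (3 / 4) ^ n) (by positivity)
    (by positivity) (by positivity) (by positivity) (le1 0) (le1 1) (le1 2)
    (key 0 1 2 (by decide) (by decide) (by decide)) (key 1 0 2 (by decide) (by decide) (by decide))
    (key 2 0 1 (by decide) (by decide) (by decide))
  calc ((∏ i, (𝒜 i).card : ℕ) : ℝ) = ((𝒜 0).card : ℝ) / 2 ^ n * (((𝒜 1).card : ℝ) / 2 ^ n) *
        (((𝒜 2).card : ℝ) / 2 ^ n) * 2 ^ (3 * n) := by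
        rw [Fin.prod_univ_three, mul_comm 3 n, pow_mul]; push_cast; field_simp
    _ ≤ _ := by gcongr

lemma maxSunflowerFreeProd_three_le (n : ℕ) :
    (maxSunflowerFreeProd n 3 : ℝ) ≤ (1 / 8 + √(3 * (3 / 4) ^ n)) * 2 ^ (3 * n) := by
  classical
  have hne : (sunflowerFreeTuples n 3).Nonempty :=
    ⟨fun _ => ∅, by simp [sunflowerFreeTuples, MulticolorSunflowerFree, HasMulticolorSunflower]⟩
  obtain ⟨𝒜, h𝒜, e⟩ := Finset.exists_mem_eq_sup _ hne
    fun 𝒜 : Fin 3 → Finset (Finset (Fin n)) => ∏ i, (𝒜 i).card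
  rw [maxSunflowerFreeProd, e]
  exact MulticolorSunflowerFree.prod_card_le (by simpa [sunflowerFreeTuples] using h𝒜)

lemma MulticolorSunflowerFree.prod_card_le_maxSunflowerFreeProd {n k : ℕ}
    {𝒜 : Fin k → Finset (Finset (Fin n))} (h : MulticolorSunflowerFree 𝒜) :
    ∏ i, (𝒜 i).card ≤ maxSunflowerFreeProd n k :=
  Finset.le_sup (f := fun 𝒜 : Fin k → Finset (Finset (Fin n)) => ∏ i, (𝒜 i).card)
    (by simpa [sunflowerFreeTuples] using h)

open Finset in
/-- The sets containing a fixed point, taken twice, and the sets avoiding it are sunflower-free. -/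
lemma multicolorSunflowerFree_mem_mem_notMem {n : ℕ} (a : Fin n) :
    MulticolorSunflowerFree ![({X | a ∈ X} : Finset (Finset (Fin n))),
      ({X | a ∈ X} : Finset (Finset (Fin n))), ({X | a ∉ X} : Finset (Finset (Fin n)))] := by
  rintro ⟨A, C, hA, hC, -⟩
  have h0 : a ∈ A 0 := by simpa using hA 0
  have h1 : a ∈ A 1 := by simpa using hA 1
  have h2 : a ∉ A 2 := by simpa using hA 2
  have e : A 0 ∩ A 1 = A 0 ∩ A 2 := (hC 0 1 (by decide)).trans (hC 0 2 (by decide)).symm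
  exact h2 (mem_inter.1 (e ▸ mem_inter.2 ⟨h0, h1⟩)).2

open Finset in
lemma pow_le_maxSunflowerFreeProd_three (n : ℕ) :
    (2 : ℝ) ^ (3 * n) / 8 ≤ maxSunflowerFreeProd n 3 := by
  rcases n with _ | n
  -- With no point to fix, the full families work: every petal is empty.
  · have h : MulticolorSunflowerFree (n := 0) (k := 3) fun _ => univ := by
      rintro ⟨A, C, -, -, hne⟩
      obtain ⟨x, -⟩ := hne 0
      exact x.elim0
    have := h.prod_card_le_maxSunflowerFreeProd
    have : (1 : ℝ) ≤ maxSunflowerFreeProd 0 3 := by exact_mod_cast (by simpa using this)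
    norm_num
    linarith
  · have hmem : #{X : Finset (Fin (n + 1)) | 0 ∈ X} = 2 ^ n := by
      have : ({X : Finset (Fin (n + 1)) | 0 ∈ X} : Finset _) = Icc {0} univ := by ext; simp
      rw [this, card_Icc_finset (subset_univ _)]; simp
    have hnot : #{X : Finset (Fin (n + 1)) | 0 ∉ X} = 2 ^ n := by
      have := card_filter_add_card_filter_not (s := (univ : Finset (Finset (Fin (n + 1)))))
        (fun X => 0 ∈ X)
      rw [hmem] at this
      simp only [card_univ, Fintype.card_finset, Fintype.card_fin, pow_succ] at this
      omega
    have h := (multicolorSunflowerFree_mem_mem_notMem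
      (0 : Fin (n + 1))).prod_card_le_maxSunflowerFreeProd
    simp only [Fin.prod_univ_three, Matrix.cons_val, hmem, hnot] at h
    have h' : (2 : ℝ) ^ n * 2 ^ n * 2 ^ n ≤ maxSunflowerFreeProd (n + 1) 3 := by exact_mod_cast h
    refine le_trans (le_of_eq ?_) h'
    ring

theorem theorem3 :
    ∃ ε₁ ε₂ : ℕ → ℝ,
      Filter.Tendsto ε₁ Filter.atTop (nhds 0) ∧ Filter.Tendsto ε₂ Filter.atTop (nhds 0) ∧
      ∀ n : ℕ,
        (1 / 8 + ε₁ n) * (2 : ℝ) ^ (3 * n) ≤ (maxSunflowerFreeProd n 3 : ℝ) ∧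
        (maxSunflowerFreeProd n 3 : ℝ) ≤ (0.13075 + ε₂ n) * (2 : ℝ) ^ (3 * n) := by
  refine ⟨fun _ => 0, fun n => √(3 * (3 / 4) ^ n), tendsto_const_nhds, ?_, fun n => ⟨?_, ?_⟩⟩
  · have h := ((tendsto_pow_atTop_nhds_zero_of_lt_one (r := (3 / 4 : ℝ))
      (by norm_num) (by norm_num)).const_mul 3).sqrt
    simpa using h
  · have := pow_le_maxSunflowerFreeProd_three n
    linarith
  · refine (maxSunflowerFreeProd_three_le n).trans ?_
    gcongr
    norm_num
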